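/- Write $e(G)$ for the number of edges of a finite simple graph $G$, let $T_r(m)$ denote the $m$-vertex Turán graph (the complete $r$-partite graph on $m$ vertices with part sizes as equal as possible, empty parts being allowed, so $T_r(m)=K_m$ if $m\le r$), and let $K_{a_1,\dots,a_k}$ denote the complete multipartite graph with parts of sizes $a_1,\dots,a_k$. A graph is Hamiltonian if it contains a Hamiltonian cycle, i.e. a cycle (of length at least $3$) through all its vertices. Let $r\ge 3$, and let $n\ge 26$ if $r=3$, $n\ge 11$ if $r=4$, and $n\ge 1$ if $r\ge 5$. If $G$ is an $n$-vertex, $K_{r+1}$-free graph that is not Hamiltonian, then $$e(G)\le e(T_r(n-1))+1 .$$ Moreover, an $n$-vertex graph $G$ is $K_{r+1}$-free, is not Hamiltonian and satisfies $e(G)=e(T_r(n-1))+1$ if and only if one of the following holds: 1. $G$ is $K_{r+1}$-free and consists of $T_r(n-1)$ plus a vertex of degree $1$ (that is, $G$ has a vertex $x$ of degree $1$ with $G-x\cong T_r(n-1)$); 2. $r\ge 5$, $n=5$ and $G\cong K_{3,1,1}$; 3. $r=4$, $n=11$ and $G\cong K_{6,2,2,1}$; 4. $r=5$, $n=7$ and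 $G\cong K_{4,1,1,1}$; 5. $r=5$, $n=9$ and $G\cong K_{5,1,1,1,1}$. -/

import Mathlib

/-- `G` contains a Hamiltonian cycle. In particular graphs on at most two vertices,
including the one-vertex graph, contain none. -/
def HasHamiltonianCycle {V : Type*} [DecidableEq V] (G : SimpleGraph V) : Prop :=
  ∃ (a : V) (p : G.Walk a a), p.IsHamiltonianCycle

/-- `G` is a `K_{r+1}`-free graph which consists of the Turán graph `T_r(n-1)`, where `n` is the
number of vertices of `G`, plus one vertex of degree `d`. -/
def IsTuranPlusVertex {V : Type*} [Fintype V] (G : SimpleGraph V) [DecidableRel G.Adj]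
    (r d : ℕ) : Prop :=
  G.CliqueFree (r + 1) ∧
    ∃ x : V, G.degree x = d ∧
      Nonempty (G.induce {v : V | v ≠ x} ≃g SimpleGraph.turanGraph (Fintype.card V - 1) r)

/-- The complete multipartite graph with `k` parts, of sizes `s 0, …, s (k - 1)`. -/
def multipartite {k : ℕ} (s : Fin k → ℕ) : SimpleGraph (Σ i : Fin k, Fin (s i)) :=
  SimpleGraph.completeMultipartiteGraph (fun i : Fin k => Fin (s i))

/-! By Chvátal's theorem a non-Hamiltonian graph `G` on `n ≥ 3` vertices has, for some `k` with
`1 ≤ k < n / 2`, at least `k` vertices of degree at most `k` and at least `n - k` vertices of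
degree less than `n - k`. Deleting `k` vertices of degree at most `k` costs at most `k ^ 2` edges,
and Turán's theorem bounds the rest, so that `e(G) ≤ k ^ 2 + e(T_r(n - k))`.

If some vertex has degree at most `1`, this is the claimed bound, and equality forces `T_r(n - 1)`
with a pendant vertex. Otherwise `k ≥ 2`, and `k ^ 2 + e(T_r(n - k)) ≤ e(T_r(n - 1))` unless
`n = 2 * k + 1` for certain pairs `(r, k)`, or `r = 3` and `n ≤ 2 * k + 2`. In the latter case the
bound is improved because neighbourhoods in a `K_4`-free graph are triangle-free. In the former
case there are `k + 1 = n - k` vertices of degree at most `k`, any `k` of which may be deleted; if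
`e(G) > e(T_r(n - 1))`, they are therefore independent and of degree exactly `k`, hence joined to
all the `k` other vertices, which span a `T_{r - 1}(k)`. -/

open SimpleGraph Finset

section Hamiltonian

variable {V : Type*} {G : SimpleGraph V}

lemma mem_edgeSet_of_mem_edges_sup_edge {u v x y : V} (huv : u ≠ v) {p : (G ⊔ edge u v).Walk x y}
    (hp : s(u, v) ∉ p.edges) : ∀ e ∈ p.edges, e ∈ G.edgeSet := by
  intro e he
  have := p.edges_subset_edgeSet he
  rw [edgeSet_sup, edgeSet_edge_of_ne huv] at this
  exact this.resolve_right fun h => hp (h ▸ he)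

lemma exists_not_adj_degree_le_forall_degree_add_le [Fintype V] [DecidableRel G.Adj] (hG : G ≠ ⊤) :
    ∃ u v, u ≠ v ∧ ¬ G.Adj u v ∧ G.degree u ≤ G.degree v ∧
      ∀ x y, x ≠ y → ¬ G.Adj x y → G.degree x + G.degree y ≤ G.degree u + G.degree v := by
  classical
  obtain ⟨a, b, hab, hnab⟩ := ne_top_iff_exists_not_adj.1 hG
  obtain ⟨⟨u, v⟩, hmem, hmax⟩ := exists_max_image
    {x : V × V | x.1 ≠ x.2 ∧ ¬ G.Adj x.1 x.2} (fun x => G.degree x.1 + G.degree x.2)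
    ⟨(a, b), by simp [hab, hnab]⟩
  simp only [mem_filter, mem_univ, true_and, Prod.forall, and_imp] at hmem hmax
  obtain ⟨huv, hnadj⟩ := hmem
  rcases le_total (G.degree u) (G.degree v) with hle | hle
  · exact ⟨u, v, huv, hnadj, hle, hmax⟩
  · exact ⟨v, u, huv.symm, fun h => hnadj h.symm, hle,
      fun x y hxy hxy' => (hmax x y hxy hxy').trans_eq (add_comm _ _)⟩

variable [DecidableEq V]

namespace HasHamiltonianCycle

lemma exists_isHamiltonianCycle (h : HasHamiltonianCycle G) (v : V) :
    ∃ p : G.Walk v v, p.IsHamiltonianCycle := by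
  obtain ⟨a, p, hp⟩ := h
  exact ⟨p.rotate v (hp.mem_support v), (Walk.isHamiltonianCycle_rotate _).2 hp⟩

lemma map {W : Type*} [DecidableEq W] {H : SimpleGraph W} (h : HasHamiltonianCycle G) (f : G →g H)
    (hf : Function.Bijective f) : HasHamiltonianCycle H := by
  obtain ⟨a, p, hp⟩ := h
  exact ⟨f a, p.map f, hp.map hf⟩

lemma two_le_degree [Fintype V] [DecidableRel G.Adj] (h : HasHamiltonianCycle G) (v : V) :
    2 ≤ G.degree v := by
  obtain ⟨p, hp⟩ := h.exists_isHamiltonianCycle v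
  have hnil := hp.isCycle.not_nil
  rw [← card_neighborFinset_eq_degree, ← card_pair hp.isCycle.snd_ne_penultimate]
  refine card_le_card (insert_subset_iff.2 ⟨?_, singleton_subset_iff.2 ?_⟩)
  · simpa only [mem_neighborFinset] using p.adj_snd hnil
  · simpa only [mem_neighborFinset] using (p.adj_penultimate hnil).symm

lemma two_mul_card_le_of_isIndepSet [Fintype V] (h : HasHamiltonianCycle G) {I : Finset V}
    (hI : G.IsIndepSet (I : Set V)) : 2 * #I ≤ Fintype.card V := by
  obtain ⟨a, p, hp⟩ := h
  have hlen : p.length = Fintype.card V := hp.length_eq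
  -- The successor along the cycle maps `I` injectively into its complement.
  have hcompl : #(((range p.length).filter fun i => p.getVert i ∈ I).image
      fun i => p.getVert (i + 1)) ≤ #Iᶜ := by
    refine card_le_card fun x hx => ?_
    simp only [mem_image, mem_filter, mem_range] at hx
    obtain ⟨i, ⟨hi, hiI⟩, rfl⟩ := hx
    have hadj := p.adj_getVert_succ hi
    exact mem_compl.2 fun hI' => hI hiI hI' hadj.ne hadj
  rw [card_image_of_injOn] at hcompl
  · have hcover : #I ≤ #((range p.length).filter fun i => p.getVert i ∈ I) := by
      refine (card_le_card fun x hx => ?_).trans (card_image_le (f := p.getVert))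
      obtain ⟨i, hi, hle⟩ := Walk.mem_support_iff_exists_getVert.1 (hp.mem_support x)
      rcases hle.lt_or_eq with hlt | rfl
      · exact mem_image.2 ⟨i, by simp [hlt, hi, hx], hi⟩
      · rw [p.getVert_length] at hi
        have hpos : 0 < p.length := hlen ▸ Fintype.card_pos_iff.2 ⟨a⟩
        exact mem_image.2 ⟨0, by simp [hpos, hi, hx], by simpa using hi⟩
    rw [card_compl] at hcompl
    have := card_le_univ I
    omega
  · intro i hi j hj hij
    simp only [coe_filter, mem_range, Set.mem_ofPred_eq] at hi hj
    have := hp.isCycle.getVert_injOn ⟨by omega, by omega⟩ ⟨by omega, by omega⟩ hij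
    omega

end HasHamiltonianCycle

lemma hasHamiltonianCycle_of_isHamiltonian_of_adj [Fintype V] (h3 : 3 ≤ Fintype.card V) {a b : V}
    {p : G.Walk a b} (hp : p.IsHamiltonian) (hab : G.Adj b a) : HasHamiltonianCycle G := by
  have hlen := hp.length_eq
  refine ⟨b, Walk.cons hab p, Walk.isHamiltonianCycle_iff_isCycle_and_length_eq.2
    ⟨(Walk.cons_isCycle_iff p hab).2 ⟨hp.isPath, fun hmem => ?_⟩, ?_⟩⟩
  · have := hp.isPath.length_eq_one_of_mem_edges (Sym2.eq_swap ▸ hmem)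
    omega
  · rw [Walk.length_cons]
    omega

lemma hasHamiltonianCycle_top [Fintype V] (h3 : 3 ≤ Fintype.card V) :
    HasHamiltonianCycle (⊤ : SimpleGraph V) := by
  obtain ⟨m, hm⟩ := Nat.exists_eq_add_of_le' h3
  let e : Fin (m + 3) ≃ V := (Fintype.equivFinOfCardEq hm).symm
  have hcycle : HasHamiltonianCycle (cycleGraph (m + 3)) :=
    ⟨0, cycleGraph.cycle m, Walk.isHamiltonianCycle_iff_isCycle_and_length_eq.2
      ⟨cycleGraph.isCycle_cycle, by rw [cycleGraph.length_cycle, Fintype.card_fin]⟩⟩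
  exact hcycle.map ⟨e, fun h => (top_adj _ _).2 (e.injective.ne h.ne)⟩ e.bijective

lemma exists_isHamiltonian_walk_of_snd_eq {u v : V} (huv : u ≠ v) {c : (G ⊔ edge u v).Walk u u}
    (hc : c.IsHamiltonianCycle) (hsnd : c.snd = v) : ∃ p : G.Walk v u, p.IsHamiltonian := by
  obtain ⟨hcycle, htail⟩ := Walk.isHamiltonianCycle_isCycle_and_isHamiltonian_tail.1 hc
  cases c with
  | nil => exact absurd hcycle Walk.not_isCycle_nil
  | cons h p =>
    rw [Walk.snd_cons] at hsnd
    subst hsnd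
    have hnot := ((Walk.cons_isCycle_iff p h).1 hcycle).2
    refine ⟨p.transfer G (mem_edgeSet_of_mem_edges_sup_edge huv hnot), fun x => ?_⟩
    rw [Walk.support_transfer]
    simpa using htail x

lemma exists_isHamiltonian_walk_of_maximal [Finite V]
    (hG : Maximal (fun H => ¬ HasHamiltonianCycle H) G) {u v : V} (huv : u ≠ v)
    (hnadj : ¬ G.Adj u v) : ∃ p : G.Walk v u, p.IsHamiltonian := by
  cases nonempty_fintype V
  have hham : HasHamiltonianCycle (G ⊔ edge u v) := by
    by_contra hno
    exact hnadj (hG.2 hno le_sup_left (Or.inr (by simp [edge_adj, huv])))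
  obtain ⟨c, hc⟩ := hham.exists_isHamiltonianCycle u
  have hmem : s(u, v) ∈ c.edges := by
    by_contra hnot
    have hcG := mem_edgeSet_of_mem_edges_sup_edge huv hnot
    exact hG.1 ⟨u, c.transfer G hcG, Walk.isHamiltonianCycle_iff_isCycle_and_length_eq.2
      ⟨hc.isCycle.transfer hcG, by rw [Walk.length_transfer, hc.length_eq]⟩⟩
  have hends : c.snd = v ∨ c.reverse.snd = v := by
    have : v ∈ c.toSubgraph.neighborSet u := (c.mem_edges_toSubgraph).2 hmem
    rw [hc.isCycle.neighborSet_toSubgraph_endpoint] at this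
    rw [Walk.snd_reverse]
    exact this.imp Eq.symm Eq.symm
  rcases hends with hsnd | hsnd
  · exact exists_isHamiltonian_walk_of_snd_eq huv hc hsnd
  · exact exists_isHamiltonian_walk_of_snd_eq huv
      (Walk.isHamiltonianCycle_iff_isCycle_and_length_eq.2
        ⟨hc.isCycle.reverse, by rw [Walk.length_reverse, hc.length_eq]⟩) hsnd

lemma hasHamiltonianCycle_of_adj_getVert_succ [Fintype V] (h3 : 3 ≤ Fintype.card V) {u v : V}
    {p : G.Walk u v} (hp : p.IsHamiltonian) {i : ℕ} (hi : i < p.length)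
    (hu : G.Adj u (p.getVert (i + 1))) (hv : G.Adj (p.getVert i) v) : HasHamiltonianCycle G := by
  let q := (p.take i).append (Walk.cons hv (p.drop (i + 1)).reverse)
  have hperm : q.support.Perm p.support := by
    simp only [q, Walk.support_append, Walk.support_take, Walk.support_cons, List.tail_cons,
      Walk.support_reverse, Walk.drop_support_eq_support_drop_min, Nat.min_eq_left hi]
    conv_rhs => rw [← List.take_append_drop (i + 1) p.support]
    exact (List.reverse_perm _).append_left _
  exact hasHamiltonianCycle_of_isHamiltonian_of_adj (p := q) h3
    (fun x => (hperm.count_eq x).trans (hp x)) hu.symm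

lemma exists_degree_le_card_forall_not_adj [Fintype V] [DecidableRel G.Adj]
    (h3 : 3 ≤ Fintype.card V) (hG : ¬ HasHamiltonianCycle G) {u v : V} {p : G.Walk u v}
    (hp : p.IsHamiltonian) :
    ∃ A : Finset V, G.degree u ≤ #A ∧ v ∉ A ∧ ∀ x ∈ A, ¬ G.Adj x v := by
  -- `A` consists of the predecessors along `p` of the neighbours of `u`.
  let I := (range p.length).filter fun i => G.Adj u (p.getVert (i + 1))
  have hI : ∀ i ∈ I, i < p.length ∧ G.Adj u (p.getVert (i + 1)) := by simp [I]
  refine ⟨I.image p.getVert, ?_, fun hv => ?_, ?_⟩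
  · rw [card_image_of_injOn fun i hi j hj hij =>
      hp.isPath.getVert_injOn (hI i hi).1.le (hI j hj).1.le hij, ← card_neighborFinset_eq_degree]
    refine (card_le_card fun x hx => ?_).trans (card_image_le (f := fun i => p.getVert (i + 1)))
    rw [mem_neighborFinset] at hx
    obtain ⟨j, rfl, hj⟩ := Walk.mem_support_iff_exists_getVert.1 (hp.mem_support x)
    cases j with
    | zero => exact absurd p.getVert_zero.symm hx.ne
    | succ i => exact mem_image.2 ⟨i, by simp [I, hx, Nat.lt_of_succ_le hj], rfl⟩
  · obtain ⟨i, hi, hiv⟩ := mem_image.1 hv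
    exact (hI i hi).1.ne ((hp.isPath.getVert_eq_end_iff (hI i hi).1.le).1 hiv)
  · intro x hx hadj
    obtain ⟨i, hi, rfl⟩ := mem_image.1 hx
    exact hG (hasHamiltonianCycle_of_adj_getVert_succ h3 hp (hI i hi).1 (hI i hi).2 hadj)

lemma exists_degree_condition_of_maximal [Fintype V] [DecidableRel G.Adj]
    (h3 : 3 ≤ Fintype.card V) (hG : Maximal (fun H => ¬ HasHamiltonianCycle H) G) :
    ∃ k, 1 ≤ k ∧ 2 * k < Fintype.card V ∧ k ≤ #{v | G.degree v ≤ k} ∧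
      Fintype.card V - k ≤ #{v | G.degree v < Fintype.card V - k} := by
  obtain ⟨u, v, huv, hnadj, hle, hmax⟩ := exists_not_adj_degree_le_forall_degree_add_le
    (G := G) fun htop => hG.1 (htop ▸ hasHamiltonianCycle_top h3)
  obtain ⟨p, hp⟩ := exists_isHamiltonian_walk_of_maximal hG huv.symm (fun h => hnadj h.symm)
  obtain ⟨A, hdeg, hvA, hA⟩ := exists_degree_le_card_forall_not_adj h3 hG.1 hp
  have hsum : G.degree u + G.degree v < Fintype.card V := by
    have hdisj : Disjoint A (insert v (G.neighborFinset v)) :=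
      disjoint_left.2 fun x hx hx' => by
        rcases mem_insert.1 hx' with rfl | hx'
        · exact hvA hx
        · exact hA x hx ((G.mem_neighborFinset v x).1 hx').symm
    have := card_le_univ (A ∪ insert v (G.neighborFinset v))
    rw [card_union_of_disjoint hdisj, card_insert_of_notMem (by simp),
      card_neighborFinset_eq_degree] at this
    omega
  refine ⟨G.degree u, ?_, by omega, hdeg.trans (card_le_card fun x hx => ?_), ?_⟩
  · exact (G.degree_pos_iff_exists_adj u).2 ⟨_, p.adj_snd (Walk.not_nil_of_ne huv)⟩
  · have := hmax x v (fun h => hvA (h ▸ hx)) (hA x hx)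
    simp only [mem_filter, mem_univ, true_and]
    omega
  · rw [← card_neighborFinset_eq_degree, ← card_compl]
    refine card_le_card fun x hx => ?_
    simp only [mem_compl, mem_neighborFinset, mem_filter, mem_univ, true_and, card_compl,
      card_neighborFinset_eq_degree] at hx ⊢
    rcases eq_or_ne u x with rfl | hux
    · omega
    · have := hmax u x hux hx
      omega

/-- **Chvátal's theorem** on degree sequences. -/
theorem exists_degree_condition_of_not_hasHamiltonianCycle [Fintype V] [DecidableRel G.Adj]
    (h3 : 3 ≤ Fintype.card V) (hG : ¬ HasHamiltonianCycle G) :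
    ∃ k, 1 ≤ k ∧ 2 * k < Fintype.card V ∧ k ≤ #{v | G.degree v ≤ k} ∧
      Fintype.card V - k ≤ #{v | G.degree v < Fintype.card V - k} := by
  classical
  obtain ⟨H, hGH, hH⟩ := Finite.exists_le_maximal
    (p := fun H : SimpleGraph V => ¬ HasHamiltonianCycle H) hG
  obtain ⟨k, hk, hcard, hle, hlt⟩ := exists_degree_condition_of_maximal h3 hH
  exact ⟨k, hk, hcard,
    hle.trans (card_le_card (monotone_filter_right _ fun v _ => (degree_le_of_le hGH).trans)),
    hlt.trans (card_le_card (monotone_filter_right _ fun v _ => (degree_le_of_le hGH).trans_lt))⟩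

end Hamiltonian

/-- The number `e(T_r(n))` of edges of the Turán graph. -/
abbrev turanEdges (n r : ℕ) : ℕ := #(turanGraph n r).edgeFinset

section Turan

variable {V : Type*} [Fintype V] {G : SimpleGraph V} [DecidableRel G.Adj] {r : ℕ}

lemma card_edgeFinset_le_turanEdges (hG : G.CliqueFree (r + 1)) :
    #G.edgeFinset ≤ turanEdges (Fintype.card V) r := by
  rw [turanEdges, card_edgeFinset_turanGraph]
  exact hG.card_edgeFinset_le

lemma nonempty_iso_turanGraph_of_turanEdges_le (hr : 0 < r) (hG : G.CliqueFree (r + 1))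
    (hle : turanEdges (Fintype.card V) r ≤ #G.edgeFinset) :
    Nonempty (G ≃g turanGraph (Fintype.card V) r) :=
  (isTuranMaximal_iff_nonempty_iso_turanGraph hr).1
    ⟨hG, fun _ _ hH => (card_edgeFinset_le_turanEdges hH).trans hle⟩

end Turan

lemma turanEdges_le_turanEdges_right {r s : ℕ} (hr : 0 < r) (hrs : r ≤ s) (n : ℕ) :
    turanEdges n r ≤ turanEdges n s := by
  simpa only [Fintype.card_fin] using
    card_edgeFinset_le_turanEdges ((turanGraph_cliqueFree (n := n) hr).mono (by omega : _ ≤ s + 1))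

lemma turanEdges_eq_choose_two {n r : ℕ} (hnr : n ≤ r) : turanEdges n r = n.choose 2 := by
  have htop := card_edgeFinset_top_eq_card_choose_two (V := Fin n)
  rw [Fintype.card_fin] at htop
  rw [← htop]
  congr!
  exact turanGraph_eq_top.2 (Or.inr hnr)

/-- A vertex added to the Turán graph is joined to all but one of the parts. -/
lemma turanEdges_succ {r : ℕ} (hr : 0 < r) (n : ℕ) :
    turanEdges (n + 1) r = turanEdges n r + (n - n / r) := by
  induction n using Nat.strong_induction_on with
  | _ n ih =>
    rcases lt_or_ge n r with h | h
    · rw [turanEdges_eq_choose_two h, turanEdges_eq_choose_two h.le, Nat.div_eq_of_lt h,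
        Nat.choose_succ_succ' n 1, Nat.choose_one_right, Nat.sub_zero, add_comm]
    · obtain ⟨m, rfl⟩ := Nat.exists_eq_add_of_le' h
      have hperiod (a : ℕ) : turanEdges (a + r) r = turanEdges a r + a * (r - 1) + r.choose 2 :=
        card_edgeFinset_turanGraph_add
      rw [add_right_comm, hperiod, hperiod, ih m (by omega), Nat.add_div_right _ hr, add_one_mul]
      have := Nat.div_le_self m r
      omega

lemma mul_turanEdges_add_le {r s : ℕ} (hs : 0 < s) (hsr : s ≤ r) (m l : ℕ) :
    s * turanEdges m r + (s - 1) * (l * m + l.choose 2) ≤ s * turanEdges (m + l) r := by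
  obtain ⟨c, rfl⟩ := Nat.exists_eq_add_of_le' hs
  induction l with
  | zero => simp
  | succ l ih =>
    have hdiv : (c + 1) * ((m + l) / r) ≤ m + l :=
      (Nat.mul_le_mul_right _ hsr).trans (Nat.mul_div_le _ r)
    have hstep : c * (m + l) ≤ (c + 1) * (m + l - (m + l) / r) := by
      rw [Nat.mul_sub, Nat.le_sub_iff_add_le (Nat.mul_le_mul_left _ (Nat.div_le_self _ r))]
      linarith
    rw [← add_assoc, turanEdges_succ (hs.trans_le hsr), Nat.choose_succ_succ' l 1,
      Nat.choose_one_right]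
    simp only [Nat.add_sub_cancel] at ih ⊢
    linarith

lemma sq_le_three_mul_turanEdges (n : ℕ) : n ^ 2 ≤ 3 * turanEdges n 3 + 1 := by
  rw [turanEdges, card_edgeFinset_turanGraph]
  obtain ⟨m, c, hc, rfl⟩ : ∃ m c, c < 3 ∧ n = 3 * m + c :=
    ⟨n / 3, n % 3, Nat.mod_lt n (by norm_num), (Nat.div_add_mod n 3).symm⟩
  rw [Nat.mul_add_mod, Nat.mod_eq_of_lt hc,
    show (3 * m + c) ^ 2 - c ^ 2 = 3 * (m * (3 * m + 2 * c)) by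
      rw [Nat.sub_eq_iff_eq_add (Nat.pow_le_pow_left (by omega) 2)]; ring,
    show 3 * (m * (3 * m + 2 * c)) * (3 - 1) / (2 * 3) = m * (3 * m + 2 * c) by omega]
  interval_cases c <;> norm_num <;> nlinarith

lemma sq_add_turanEdges_le {r s k m : ℕ} (hs : 0 < s) (hsr : s ≤ r)
    (h : s * k ^ 2 < (s - 1) * ((k - 1) * m + (k - 1).choose 2) + s) :
    k ^ 2 + turanEdges m r ≤ turanEdges (m + (k - 1)) r := by
  have := mul_turanEdges_add_le hs hsr m (k - 1)
  refine Nat.le_of_lt_succ (Nat.lt_of_mul_lt_mul_left (a := s) ?_)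
  rw [Nat.mul_add, Nat.succ_eq_add_one, mul_add_one]
  omega

lemma two_mul_choose_two_add_one (j : ℕ) : 2 * (j + 1).choose 2 = j * (j + 1) := by
  rw [mul_comm, ← Nat.add_one_mul_choose_eq j 1, Nat.choose_one_right, mul_comm]

/-- The pairs `(r, k)` for which `k ^ 2 + e(T_r(k + 1))` exceeds `e(T_r(2 * k))`, where
`11 ≤ 2 * k + 1` if `r = 4`; these give the sporadic extremal graphs, on `2 * k + 1` vertices. -/
def IsExceptional (r k : ℕ) : Prop :=
  5 ≤ r ∧ k = 2 ∨ r = 4 ∧ k = 5 ∨ r = 5 ∧ k = 3 ∨ r = 5 ∧ k = 4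

lemma sq_add_turanEdges_le_of_three {k m : ℕ} (hk : 2 ≤ k) (hm : k + 3 ≤ m) :
    k ^ 2 + turanEdges m 3 ≤ turanEdges (m + (k - 1)) 3 := by
  refine sq_add_turanEdges_le (by norm_num) le_rfl ?_
  obtain ⟨j, rfl⟩ := Nat.exists_eq_add_of_le' hk
  have := two_mul_choose_two_add_one j
  simp only [Nat.reduceSubDiff]
  nlinarith

lemma sq_add_turanEdges_le_of_four {k m : ℕ} (hk : 2 ≤ k) (hkm : k < m) (hn : 11 ≤ m + k)
    (hex : m = k + 1 → ¬ IsExceptional 4 k) :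
    k ^ 2 + turanEdges m 4 ≤ turanEdges (m + (k - 1)) 4 := by
  by_cases h : m = k + 1 ∧ k ≤ 8
  · obtain ⟨rfl, hk8⟩ := h
    replace hex := hex rfl
    have : 5 ≤ k := by omega
    interval_cases k <;>
      simp_all [IsExceptional, turanEdges, card_edgeFinset_turanGraph, Nat.choose]
  · refine sq_add_turanEdges_le (by norm_num) le_rfl ?_
    obtain ⟨j, rfl⟩ := Nat.exists_eq_add_of_le' hk
    have := two_mul_choose_two_add_one j
    simp only [Nat.reduceSubDiff]
    obtain ⟨i, rfl⟩ := Nat.exists_eq_add_of_lt hkm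
    rcases Nat.eq_zero_or_pos i with rfl | hi
    · have hj : 7 ≤ j := by omega
      nlinarith
    rcases Nat.eq_zero_or_pos j with rfl | hj
    · omega
    · nlinarith [hj]

lemma sq_add_turanEdges_le_of_five_le {r k m : ℕ} (hr : 5 ≤ r) (hk : 2 ≤ k) (hkm : k < m)
    (hex : m = k + 1 → ¬ IsExceptional r k) :
    k ^ 2 + turanEdges m r ≤ turanEdges (m + (k - 1)) r := by
  by_cases h : m = k + 1 ∧ k ≤ 5
  · obtain ⟨rfl, hk5⟩ := h
    have h3 : 3 ≤ k := by
      by_contra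
      exact hex rfl (Or.inl ⟨hr, by omega⟩)
    replace hex := hex rfl
    rcases hr.eq_or_lt with rfl | hr
    · interval_cases k <;>
        simp_all [IsExceptional, turanEdges, card_edgeFinset_turanGraph, Nat.choose]
    · have hmono := turanEdges_le_turanEdges_right (by norm_num) (Nat.succ_le_of_lt hr)
        (k + 1 + (k - 1))
      rw [turanEdges_eq_choose_two (by omega)]
      refine le_trans ?_ hmono
      interval_cases k <;> simp [turanEdges, card_edgeFinset_turanGraph, Nat.choose]
  · refine sq_add_turanEdges_le (by norm_num) hr ?_
    obtain ⟨j, rfl⟩ := Nat.exists_eq_add_of_le' hk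
    have := two_mul_choose_two_add_one j
    simp only [Nat.reduceSubDiff]
    obtain ⟨i, rfl⟩ := Nat.exists_eq_add_of_lt hkm
    rcases Nat.eq_zero_or_pos i with rfl | hi
    · have hj : 4 ≤ j := by omega
      nlinarith
    · nlinarith

namespace IsExceptional

variable {r k : ℕ}

lemma two_le_left (h : IsExceptional r k) : 2 ≤ r := by
  unfold IsExceptional at h
  omega

lemma two_le_right (h : IsExceptional r k) : 2 ≤ k := by
  unfold IsExceptional at h
  omega

lemma sq_add_turanEdges (h : IsExceptional r k) :
    k ^ 2 + turanEdges (k + 1) r = turanEdges (2 * k) r + 1 := by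
  rcases h with ⟨hr, rfl⟩ | ⟨rfl, rfl⟩ | ⟨rfl, rfl⟩ | ⟨rfl, rfl⟩
  · simp [turanEdges_eq_choose_two (by omega : 3 ≤ r),
      turanEdges_eq_choose_two (by omega : 4 ≤ r), Nat.choose]
  all_goals simp [turanEdges, card_edgeFinset_turanGraph, Nat.choose]

lemma turanEdges_sub_one (h : IsExceptional r k) :
    turanEdges k (r - 1) + k = turanEdges (k + 1) r := by
  rcases h with ⟨hr, rfl⟩ | ⟨rfl, rfl⟩ | ⟨rfl, rfl⟩ | ⟨rfl, rfl⟩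
  · simp [turanEdges_eq_choose_two (by omega : 3 ≤ r),
      turanEdges_eq_choose_two (by omega : 2 ≤ r - 1), Nat.choose]
  all_goals simp [turanEdges, card_edgeFinset_turanGraph, Nat.choose]

end IsExceptional

section EdgeCount

variable {V : Type*} {G : SimpleGraph V}

lemma cliqueFree_induce {n : ℕ} (h : G.CliqueFree n) (X : Set V) : (G.induce X).CliqueFree n :=
  h.comap ⟨Copy.induce G X⟩

lemma cliqueFree_comap_of_forall_adj {W : Type*} {n : ℕ} (h : G.CliqueFree (n + 1)) (f : W ↪ V)
    {v : V} (hv : ∀ x, G.Adj v (f x)) : (G.comap f).CliqueFree n := by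
  classical
  intro K hK
  have hK' : G.IsNClique n (K.map f) := hK.map.mono (map_comap_le _ _)
  refine h _ (hK'.insert (a := v) fun x hx => ?_)
  obtain ⟨y, -, rfl⟩ := mem_map.1 hx
  exact hv y

variable [DecidableRel G.Adj]

lemma sum_card_filter_adj_eq (X : Finset V) :
    ∑ v ∈ X, #{x ∈ X | G.Adj v x} = 2 * #(G.induce (X : Set V)).edgeFinset := by
  rw [← sum_degrees_eq_twice_card_edges, ← sum_coe_sort X]
  refine sum_congr rfl fun v _ => (card_bij (fun x _ => x.1) ?_ ?_ ?_).symm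
  · intro x hx
    exact mem_filter.2 ⟨x.2, by simpa using hx⟩
  · intro x _ y _ h
    exact Subtype.ext h
  · intro x hx
    obtain ⟨hxX, hvx⟩ := mem_filter.1 hx
    exact ⟨⟨x, hxX⟩, by simpa using hvx, rfl⟩

lemma card_edgeFinset_induce_le_turanEdges {r : ℕ} {X : Finset V}
    (h : (G.induce (X : Set V)).CliqueFree (r + 1)) :
    #(G.induce (X : Set V)).edgeFinset ≤ turanEdges #X r := by
  simpa using card_edgeFinset_le_turanEdges h

variable [Fintype V]

lemma card_filter_adj_le_degree (X : Finset V) (v : V) : #{x ∈ X | G.Adj v x} ≤ G.degree v := by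
  rw [degree, neighborFinset_eq_filter]
  exact card_le_card (filter_subset_filter _ (subset_univ X))

variable [DecidableEq V]

lemma degree_eq_card_filter_add_card_filter_compl (X : Finset V) (v : V) :
    G.degree v = #{x ∈ X | G.Adj v x} + #{x ∈ Xᶜ | G.Adj v x} := by
  rw [← card_union_of_disjoint (disjoint_filter_filter disjoint_compl_right), ← filter_union,
    union_compl, ← neighborFinset_eq_filter, degree]

lemma two_mul_card_edgeFinset_eq (S : Finset V) :
    2 * #G.edgeFinset = 2 * #(G.induce ((Sᶜ : Finset V) : Set V)).edgeFinset +
      ∑ v ∈ S, (G.degree v + #{x ∈ Sᶜ | G.Adj v x}) := by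
  have hcross : ∑ v ∈ Sᶜ, #{x ∈ S | G.Adj v x} = ∑ v ∈ S, #{x ∈ Sᶜ | G.Adj v x} := by
    simpa only [bipartiteAbove, bipartiteBelow, G.adj_comm] using
      sum_card_bipartiteAbove_eq_sum_card_bipartiteBelow (s := Sᶜ) (t := S) G.Adj
  have hcompl : ∑ v ∈ Sᶜ, G.degree v =
      2 * #(G.induce ((Sᶜ : Finset V) : Set V)).edgeFinset +
        ∑ v ∈ S, #{x ∈ Sᶜ | G.Adj v x} := by
    rw [← sum_card_filter_adj_eq, ← hcross, ← sum_add_distrib]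
    exact sum_congr rfl fun v _ => by
      rw [degree_eq_card_filter_add_card_filter_compl S, add_comm]
  rw [← sum_degrees_eq_twice_card_edges, ← sum_add_sum_compl S, hcompl, sum_add_distrib]
  ring

lemma two_mul_card_edgeFinset_le {S : Finset V} {k a : ℕ} (hk : ∀ v ∈ S, G.degree v ≤ k)
    (ha : ∀ v ∈ S, #{x ∈ Sᶜ | G.Adj v x} ≤ a) :
    2 * #G.edgeFinset ≤
      2 * #(G.induce ((Sᶜ : Finset V) : Set V)).edgeFinset + #S * (k + a) := by
  rw [two_mul_card_edgeFinset_eq S]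
  gcongr
  exact sum_le_card_nsmul _ _ _ fun v hv => add_le_add (hk v hv) (ha v hv)

lemma card_edgeFinset_le_sq_add {r k : ℕ} (hG : G.CliqueFree (r + 1)) {S : Finset V}
    (hS : #S = k) (hdeg : ∀ v ∈ S, G.degree v ≤ k) :
    #G.edgeFinset ≤ k ^ 2 + turanEdges #Sᶜ r := by
  have hedges := two_mul_card_edgeFinset_le hdeg fun v hv =>
    (card_filter_adj_le_degree Sᶜ v).trans (hdeg v hv)
  have hturan := card_edgeFinset_induce_le_turanEdges (cliqueFree_induce hG (Sᶜ : Finset V))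
  rw [hS] at hedges
  nlinarith

lemma degree_eq_and_isIndepSet_of_sq_add_le {r k : ℕ} (hG : G.CliqueFree (r + 1))
    {S : Finset V} (hS : #S = k) (hdeg : ∀ v ∈ S, G.degree v ≤ k)
    (hle : k ^ 2 + turanEdges #Sᶜ r ≤ #G.edgeFinset) :
    (∀ v ∈ S, G.degree v = k) ∧ G.IsIndepSet (S : Set V) := by
  have hturan := card_edgeFinset_induce_le_turanEdges (cliqueFree_induce hG (Sᶜ : Finset V))
  have hcross (v : V) (hv : v ∈ S) : G.degree v + #{x ∈ Sᶜ | G.Adj v x} ≤ k + k :=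
    add_le_add (hdeg v hv) ((card_filter_adj_le_degree Sᶜ v).trans (hdeg v hv))
  have hsum : ∑ v ∈ S, (G.degree v + #{x ∈ Sᶜ | G.Adj v x}) = ∑ _v ∈ S, (k + k) := by
    refine (sum_le_sum hcross).antisymm ?_
    have hedges := two_mul_card_edgeFinset_eq (G := G) S
    rw [sum_const, hS, smul_eq_mul]
    nlinarith
  have heq := (sum_eq_sum_iff_of_le hcross).1 hsum
  have hsplit (v : V) := degree_eq_card_filter_add_card_filter_compl (G := G) S v
  refine ⟨fun v hv => ?_, fun v hv w hw _ hvw => ?_⟩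
  · have := hdeg v hv
    have := heq v hv
    have := hsplit v
    omega
  · have hpos : 0 < #{x ∈ S | G.Adj v x} := card_pos.2 ⟨w, mem_filter.2 ⟨hw, hvw⟩⟩
    have := hdeg v hv
    have := heq v hv
    have := hsplit v
    omega

lemma two_mul_card_edgeFinset_le_of_cliqueFree_induce_compl {s : ℕ} {S : Finset V}
    (hS : (G.induce ((Sᶜ : Finset V) : Set V)).CliqueFree (s + 1)) :
    2 * #G.edgeFinset ≤ 2 * turanEdges #Sᶜ s + #S * (Fintype.card V - 1 + #Sᶜ) := by
  have hedges := two_mul_card_edgeFinset_le (G := G) (S := S)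
    (fun v _ => Nat.le_sub_one_of_lt (G.degree_lt_card_verts v)) (fun v _ => card_filter_le Sᶜ _)
  have hturan := card_edgeFinset_induce_le_turanEdges hS
  omega

/-- The neighbours of `v` outside `S` span a triangle-free graph, so Mantel's theorem applies. -/
lemma four_mul_card_edgeFinset_induce_compl_le (hG : G.CliqueFree 4) (S : Finset V) (v : V) :
    4 * #(G.induce ((Sᶜ : Finset V) : Set V)).edgeFinset ≤ #{x ∈ Sᶜ | G.Adj v x} ^ 2 +
      2 * ((#Sᶜ - #{x ∈ Sᶜ | G.Adj v x}) * (#Sᶜ - 1 + #{x ∈ Sᶜ | G.Adj v x})) := by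
  let X : Finset (Sᶜ : Finset V) := {x | ¬ G.Adj v x}
  have hX : #Xᶜ = #{x ∈ Sᶜ | G.Adj v x} := by
    simp only [X, compl_filter, not_not, card_filter]
    exact sum_coe_sort Sᶜ fun x => if G.Adj v x then 1 else 0
  have hXS : #X = #Sᶜ - #{x ∈ Sᶜ | G.Adj v x} := by
    have := card_add_card_compl X
    rw [Fintype.card_coe] at this
    omega
  have hfree : ((G.induce ((Sᶜ : Finset V) : Set V)).induce
      ((Xᶜ : Finset _) : Set _)).CliqueFree 3 :=
    cliqueFree_comap_of_forall_adj hG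
      ((Function.Embedding.subtype _).trans (Function.Embedding.subtype _))
      fun x => by
        have := x.2
        simp only [X, compl_filter, not_not, coe_filter] at this
        exact this.2
  have hedges := two_mul_card_edgeFinset_le_of_cliqueFree_induce_compl hfree
  have hmantel := mul_card_edgeFinset_turanGraph_le (n := #Xᶜ) (r := 2)
  have hcard : Fintype.card ((Sᶜ : Finset V) : Set V) = #Sᶜ := Fintype.card_coe _
  rw [turanEdges, hX, hXS, hcard] at hedges
  rw [hX] at hmantel
  omega

/-- For a set `S` of `k` vertices of degree at most `k`, with `m = #Sᶜ`: `e` stands for `e(G)`, `w`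
for `e(G - S)`, `a` for the maximum over `S` of the number of neighbours outside `S`, and `T` for
`e(T_3(m + (k - 1)))`. -/
lemma edges_le_of_neighbors_le {k m a w e T : ℕ} (hk : 12 ≤ k) (hm : m = k + 1 ∨ m = k + 2)
    (ha : a ≤ k) (he : 2 * e ≤ 2 * w + k * (k + a)) (hw : 3 * w ≤ m ^ 2)
    (hwa : 4 * w ≤ a ^ 2 + 2 * ((m - a) * (m - 1 + a))) (hT : (m + (k - 1)) ^ 2 ≤ 3 * T + 1) :
    e ≤ T := by
  refine Nat.le_of_lt_succ ?_
  obtain ⟨b, rfl⟩ := Nat.exists_eq_add_of_le ha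
  obtain rfl | rfl := hm
  · rw [show a + b + 1 - a = b + 1 by omega, Nat.add_sub_cancel] at hwa
    rw [show a + b + 1 + (a + b - 1) = 2 * (a + b) by omega] at hT
    rcases (show b = 0 ∨ b = 1 ∨ 2 ≤ b by omega) with rfl | rfl | hb
    · nlinarith
    · nlinarith
    · nlinarith [hb]
  · rw [show a + b + 2 - a = b + 2 by omega, show a + b + 2 - 1 = a + b + 1 by omega] at hwa
    rw [show a + b + 2 + (a + b - 1) = 2 * (a + b) + 1 by omega] at hT
    rcases (show b = 0 ∨ 1 ≤ b by omega) with rfl | hb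
    · nlinarith
    · nlinarith [hb]

lemma card_edgeFinset_le_of_cliqueFree_four {k : ℕ} (hk : 12 ≤ k) (hG : G.CliqueFree 4)
    {S : Finset V} (hS : #S = k) (hdeg : ∀ v ∈ S, G.degree v ≤ k)
    (hm : #Sᶜ = k + 1 ∨ #Sᶜ = k + 2) :
    #G.edgeFinset ≤ turanEdges (#Sᶜ + (k - 1)) 3 := by
  obtain ⟨v, hv, hmax⟩ :=
    exists_max_image S (fun v => #{x ∈ Sᶜ | G.Adj v x}) (card_pos.1 (by omega))
  have hedges := two_mul_card_edgeFinset_le hdeg hmax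
  rw [hS] at hedges
  have hturan := card_edgeFinset_induce_le_turanEdges (cliqueFree_induce hG (Sᶜ : Finset V))
  have hturan' := mul_card_edgeFinset_turanGraph_le (n := #Sᶜ) (r := 3)
  exact edges_le_of_neighbors_le hk hm ((card_filter_adj_le_degree _ v).trans (hdeg v hv)) hedges
    (by rw [turanEdges] at hturan; omega) (four_mul_card_edgeFinset_induce_compl_le hG S v)
    (sq_le_three_mul_turanEdges _)

end EdgeCount

section Multipartite

variable {m : ℕ} {s : Fin m → ℕ}

lemma cliqueFree_multipartite {n : ℕ} (h : m < n) : (multipartite s).CliqueFree n :=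
  cliqueFree_completeMultipartiteGraph _ (by simpa using h)

lemma card_filter_fst_eq (s : Fin m → ℕ) (i : Fin m) :
    #{v : Σ j : Fin m, Fin (s j) | v.1 = i} = s i := by
  rw [← Fintype.card_subtype, Fintype.card_congr (Equiv.sigmaSubtype i), Fintype.card_fin]

lemma not_hasHamiltonianCycle_multipartite {i : Fin m} (h : ∑ j, s j < 2 * s i) :
    ¬ HasHamiltonianCycle (multipartite s) := by
  intro hham
  have hle := hham.two_mul_card_le_of_isIndepSet (I := {v | v.1 = i}) fun v hv w hw _ hvw => hvw
    (by simpa using (mem_filter.1 hv).2.trans (mem_filter.1 hw).2.symm)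
  rw [card_filter_fst_eq, Fintype.card_sigma] at hle
  simp only [Fintype.card_fin] at hle
  omega

lemma two_mul_card_edgeFinset_multipartite [DecidableRel (multipartite s).Adj] :
    2 * #(multipartite s).edgeFinset = ∑ i, s i * (∑ j, s j - s i) := by
  have hdeg (v : Σ i, Fin (s i)) : (multipartite s).degree v = ∑ j, s j - s v.1 := by
    have hnbrs : (multipartite s).neighborFinset v = ({w | w.1 = v.1} : Finset _)ᶜ := by
      ext w
      rw [mem_neighborFinset]
      simp [multipartite, eq_comm]
    rw [degree, hnbrs, card_compl, card_filter_fst_eq]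
    simp
  simp [← sum_degrees_eq_twice_card_edges, hdeg, Fintype.sum_sigma]

variable {V : Type*} [Fintype V] {G : SimpleGraph V}

lemma nonempty_iso_multipartite (c : V → Fin m) (hadj : ∀ x y, G.Adj x y ↔ c x ≠ c y)
    (hs : ∀ i, #{v | c v = i} = s i) : Nonempty (G ≃g multipartite s) := by
  have hcard (i : Fin m) : Fintype.card {v // c v = i} = s i := by rw [Fintype.card_subtype, hs]
  refine ⟨⟨(Equiv.sigmaFiberEquiv c).symm.trans
    (Equiv.sigmaCongrRight fun i => Fintype.equivFinOfCardEq (hcard i)), fun {x y} => ?_⟩⟩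
  rw [hadj]
  simp [multipartite, Equiv.sigmaFiberEquiv]

lemma nonempty_iso_multipartite_cons [DecidableEq V] {I : Finset V}
    (hI : G.IsIndepSet (I : Set V)) (hjoin : ∀ x ∈ I, ∀ y ∉ I, G.Adj x y)
    (e : G.induce ((Iᶜ : Finset V) : Set V) ≃g multipartite s) :
    Nonempty (G ≃g multipartite (Matrix.vecCons #I s)) := by
  let c (v : V) : Fin (m + 1) :=
    if h : v ∈ Iᶜ then (e ⟨v, h⟩).1.succ else 0
  have hcI {v : V} (hv : v ∈ I) : c v = 0 := dif_neg (by simpa using hv)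
  have hcI' {v : V} (hv : v ∈ Iᶜ) : c v = (e ⟨v, hv⟩).1.succ := dif_pos hv
  refine nonempty_iso_multipartite c (fun x y => ?_) fun i => ?_
  · by_cases hx : x ∈ I <;> by_cases hy : y ∈ I
    · simpa [hcI hx, hcI hy] using fun hxy => hI hx hy hxy.ne hxy
    · simpa [hcI hx, hcI' (mem_compl.2 hy), (Fin.succ_ne_zero _).symm] using hjoin x hx y hy
    · simpa [hcI' (mem_compl.2 hx), hcI hy] using (hjoin y hy x hx).symm
    · rw [hcI' (mem_compl.2 hx), hcI' (mem_compl.2 hy), Ne, Fin.succ_inj]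
      exact (e.map_adj_iff (v := ⟨x, mem_compl.2 hx⟩) (w := ⟨y, mem_compl.2 hy⟩)).symm
  · cases i using Fin.cases with
    | zero =>
      refine congrArg card (Finset.ext fun v => ?_)
      by_cases hv : v ∈ I
      · simp [hv, hcI hv]
      · simp [hv, hcI' (mem_compl.2 hv)]
    | succ i =>
      rw [Matrix.cons_val_succ, ← card_filter_fst_eq s i]
      refine (card_bij (fun x _ => (e.symm x).1) (fun x hx => ?_) (fun x _ y _ h => ?_)
        fun v hv => ?_).symm
      · simpa [hcI' (e.symm x).2] using hx
      · exact e.symm.injective (Subtype.ext h)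
      · by_cases hvI : v ∈ I
        · simp [hcI hvI, (Fin.succ_ne_zero i).symm] at hv
        · exact ⟨e ⟨v, mem_compl.2 hvI⟩, by simpa [hcI' (mem_compl.2 hvI)] using hv, by simp⟩

end Multipartite

/-- The graphs other than `T_r(n - 1)` with a pendant vertex which attain the bound for graphs on
`n` vertices. -/
def IsSporadicExtremal {V : Type*} (G : SimpleGraph V) (n r : ℕ) : Prop :=
  (5 ≤ r ∧ n = 5 ∧ Nonempty (G ≃g multipartite ![3, 1, 1])) ∨
    (r = 4 ∧ n = 11 ∧ Nonempty (G ≃g multipartite ![6, 2, 2, 1])) ∨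
    (r = 5 ∧ n = 7 ∧ Nonempty (G ≃g multipartite ![4, 1, 1, 1])) ∨
    (r = 5 ∧ n = 9 ∧ Nonempty (G ≃g multipartite ![5, 1, 1, 1, 1]))

namespace IsSporadicExtremal

variable {V : Type*} {G : SimpleGraph V} {n r : ℕ}

lemma cliqueFree (h : IsSporadicExtremal G n r) : G.CliqueFree (r + 1) := by
  rcases h with ⟨hr, -, ⟨e⟩⟩ | ⟨rfl, -, ⟨e⟩⟩ | ⟨rfl, -, ⟨e⟩⟩ | ⟨rfl, -, ⟨e⟩⟩ <;>
    exact (cliqueFree_multipartite (by omega)).comap e.isContained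

lemma not_hasHamiltonianCycle [DecidableEq V] (h : IsSporadicExtremal G n r) :
    ¬ HasHamiltonianCycle G := by
  intro hham
  rcases h with ⟨-, -, ⟨e⟩⟩ | ⟨-, -, ⟨e⟩⟩ | ⟨-, -, ⟨e⟩⟩ | ⟨-, -, ⟨e⟩⟩ <;>
    exact not_hasHamiltonianCycle_multipartite (i := 0) (by decide)
      (hham.map e.toHom e.bijective)

lemma card_edgeFinset [Fintype V] [DecidableRel G.Adj] (h : IsSporadicExtremal G n r) :
    #G.edgeFinset = turanEdges (n - 1) r + 1 := by
  classical
  refine Nat.eq_of_mul_eq_mul_left two_pos ?_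
  rcases h with ⟨hr, rfl, ⟨e⟩⟩ | ⟨rfl, rfl, ⟨e⟩⟩ | ⟨rfl, rfl, ⟨e⟩⟩ | ⟨rfl, rfl, ⟨e⟩⟩ <;>
    rw [e.card_edgeFinset_eq, two_mul_card_edgeFinset_multipartite]
  · rw [turanEdges_eq_choose_two (by omega)]
    decide
  all_goals
    rw [turanEdges, card_edgeFinset_turanGraph]
    decide

end IsSporadicExtremal

lemma IsExceptional.isSporadicExtremal {V : Type*} [Fintype V] [DecidableEq V]
    {G : SimpleGraph V} {r k : ℕ} (h : IsExceptional r k) {I : Finset V} (hcard : #I = k + 1)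
    (hI : G.IsIndepSet (I : Set V)) (hjoin : ∀ x ∈ I, ∀ y ∉ I, G.Adj x y)
    (hturan : Nonempty (G.induce ((Iᶜ : Finset V) : Set V) ≃g turanGraph k (r - 1))) :
    IsSporadicExtremal G (2 * k + 1) r := by
  have key {m : ℕ} {s : Fin m → ℕ} (hs : Nonempty (turanGraph k (r - 1) ≃g multipartite s)) :
      Nonempty (G ≃g multipartite (Matrix.vecCons (k + 1) s)) := by
    obtain ⟨e⟩ := hturan
    obtain ⟨f⟩ := hs
    exact hcard ▸ nonempty_iso_multipartite_cons hI hjoin (f.comp e)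
  rcases h with ⟨hr, rfl⟩ | ⟨rfl, rfl⟩ | ⟨rfl, rfl⟩ | ⟨rfl, rfl⟩
  · have htop : turanGraph 2 (r - 1) = ⊤ := turanGraph_eq_top.2 (Or.inr (by omega))
    rw [htop] at key
    exact Or.inl ⟨hr, rfl, key (nonempty_iso_multipartite (s := ![1, 1]) id (by simp) (by decide))⟩
  · exact Or.inr (Or.inl ⟨rfl, rfl, key (nonempty_iso_multipartite (s := ![2, 2, 1])
      ![0, 1, 2, 0, 1] (by decide) (by decide))⟩)
  · exact Or.inr (Or.inr (Or.inl ⟨rfl, rfl, key (nonempty_iso_multipartite (s := ![1, 1, 1]) id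
      (by decide) (by decide))⟩))
  · exact Or.inr (Or.inr (Or.inr ⟨rfl, rfl, key (nonempty_iso_multipartite (s := ![1, 1, 1, 1]) id
      (by decide) (by decide))⟩))

section Extremal

variable {V : Type*} [Fintype V] {G : SimpleGraph V} [DecidableRel G.Adj] {r : ℕ}

lemma card_edgeFinset_induce_ne_add_degree [DecidableEq V] (u : V) :
    #(G.induce {v | v ≠ u}).edgeFinset + G.degree u = #G.edgeFinset := by
  have hdelete := (G.card_edgeFinset_induce_compl_singleton u).trans
    (G.card_edgeFinset_deleteIncidenceSet u)
  have hle := card_le_card (G.incidenceFinset_subset u)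
  rw [card_incidenceFinset_eq_degree] at hle
  change #(G.induce {v | v ≠ u}).edgeFinset = _ at hdelete
  omega

lemma card_edgeFinset_le_or_isTuranPlusVertex (hr : 0 < r) (hG : G.CliqueFree (r + 1)) {u : V}
    (hu : G.degree u ≤ 1) :
    #G.edgeFinset ≤ turanEdges (Fintype.card V - 1) r ∨
      #G.edgeFinset = turanEdges (Fintype.card V - 1) r + 1 ∧ IsTuranPlusVertex G r 1 := by
  classical
  have hedges := card_edgeFinset_induce_ne_add_degree (G := G) u
  have hfree := cliqueFree_induce hG {v | v ≠ u}
  have hcard : Fintype.card {v : V | v ≠ u} = Fintype.card V - 1 :=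
    Set.card_ne_eq u
  have hturan := card_edgeFinset_le_turanEdges hfree
  have hiso := nonempty_iso_turanGraph_of_turanEdges_le hr hfree
  rw [hcard] at hturan hiso
  exact or_iff_not_imp_left.2 fun hlt => ⟨by omega, hG, u, by omega, hiso (by omega)⟩

namespace IsTuranPlusVertex

lemma card_edgeFinset {d : ℕ} (h : IsTuranPlusVertex G r d) :
    #G.edgeFinset = turanEdges (Fintype.card V - 1) r + d := by
  classical
  obtain ⟨-, x, hx, ⟨e⟩⟩ := h
  rw [← card_edgeFinset_induce_ne_add_degree x, hx, e.card_edgeFinset_eq]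

lemma not_hasHamiltonianCycle [DecidableEq V] (h : IsTuranPlusVertex G r 1) :
    ¬ HasHamiltonianCycle G := by
  obtain ⟨-, x, hx, -⟩ := h
  intro hham
  have := hham.two_le_degree x
  omega

end IsTuranPlusVertex

lemma degree_eq_and_isIndepSet_of_card_eq_add_one [DecidableEq V] {k : ℕ} (hk : 2 ≤ k)
    (hG : G.CliqueFree (r + 1)) {I : Finset V} (hI : #I = k + 1) (hdeg : ∀ v ∈ I, G.degree v ≤ k)
    (hle : k ^ 2 + turanEdges (#Iᶜ + 1) r ≤ #G.edgeFinset) :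
    (∀ v ∈ I, G.degree v = k) ∧ G.IsIndepSet (I : Set V) := by
  have hsubset {v w : V} (hv : v ∈ I) (hw : w ∈ I) :
      ∃ S : Finset V, v ∈ S ∧ w ∈ S ∧ (∀ x ∈ S, G.degree x = k) ∧ G.IsIndepSet (S : Set V) := by
    obtain ⟨S, hvwS, hSI, hS⟩ := exists_subsuperset_card_eq
      (insert_subset hv (singleton_subset_iff.2 hw)) (card_le_two.trans hk) (by omega : k ≤ #I)
    have hcompl : #Sᶜ = #Iᶜ + 1 := by
      have := card_add_card_compl S
      have := card_add_card_compl I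
      omega
    exact ⟨S, hvwS (mem_insert_self v {w}), hvwS (mem_insert_of_mem (mem_singleton_self w)),
      degree_eq_and_isIndepSet_of_sq_add_le hG hS (fun x hx => hdeg x (hSI hx)) (hcompl ▸ hle)⟩
  refine ⟨fun v hv => ?_, fun v hv w hw => ?_⟩
  · obtain ⟨S, hvS, -, hSdeg, -⟩ := hsubset hv hv
    exact hSdeg v hvS
  · obtain ⟨S, hvS, hwS, -, hS⟩ := hsubset hv hw
    exact hS hvS hwS

lemma adj_of_isIndepSet_of_card_compl_le_degree [DecidableEq V] {I : Finset V}
    (hI : G.IsIndepSet (I : Set V)) {v w : V} (hv : v ∈ I) (hw : w ∉ I)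
    (hdeg : #Iᶜ ≤ G.degree v) : G.Adj v w := by
  have hsub : G.neighborFinset v ⊆ Iᶜ := fun x hx => by
    have hvx : G.Adj v x := (mem_neighborFinset ..).1 hx
    exact mem_compl.2 fun hxI => hI hv hxI hvx.ne hvx
  rw [← mem_neighborFinset, eq_of_subset_of_card_le hsub hdeg]
  exact mem_compl.2 hw

lemma isSporadicExtremal_of_isExceptional {k : ℕ} (hrk : IsExceptional r k)
    (hV : Fintype.card V = 2 * k + 1) (hG : G.CliqueFree (r + 1))
    (hlow : k + 1 ≤ #{v | G.degree v ≤ k})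
    (hlt : turanEdges (2 * k) r < #G.edgeFinset) : IsSporadicExtremal G (2 * k + 1) r := by
  classical
  have hle : k ^ 2 + turanEdges (k + 1) r ≤ #G.edgeFinset := hrk.sq_add_turanEdges ▸ hlt
  obtain ⟨I, hIlow, hIcard⟩ := exists_subset_card_eq hlow
  have hcompl : #Iᶜ = k := by rw [card_compl]; omega
  obtain ⟨hdeg, hI⟩ := degree_eq_and_isIndepSet_of_card_eq_add_one hrk.two_le_right hG
    hIcard (fun v hv => (mem_filter.1 (hIlow hv)).2) (hcompl.symm ▸ hle)
  have hjoin : ∀ v ∈ I, ∀ w ∉ I, G.Adj v w := fun v hv w hw =>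
    adj_of_isIndepSet_of_card_compl_le_degree hI hv hw (hcompl.trans (hdeg v hv).symm).le
  obtain ⟨r, rfl⟩ := Nat.exists_eq_add_of_le' hrk.two_le_left
  refine hrk.isSporadicExtremal hIcard hI hjoin ?_
  obtain ⟨v, hv⟩ := card_pos.1 (by omega : 0 < #I)
  have hfree : (G.induce ((Iᶜ : Finset V) : Set V)).CliqueFree (r + 1 + 1) :=
    cliqueFree_comap_of_forall_adj hG (Function.Embedding.subtype _)
      fun x => hjoin v hv x (mem_compl.1 x.2)
  have hedges := two_mul_card_edgeFinset_le (S := I) (fun v hv => (hdeg v hv).le)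
    fun v hv => (card_filter_adj_le_degree Iᶜ v).trans (hdeg v hv).le
  have hturan := hrk.turanEdges_sub_one
  have hcardI : Fintype.card ((Iᶜ : Finset V) : Set V) = k := (Fintype.card_coe _).trans hcompl
  have hiso := nonempty_iso_turanGraph_of_turanEdges_le r.succ_pos hfree
  rw [hcardI] at hiso
  rw [hIcard] at hedges
  rw [show r + 2 - 1 = r + 1 by omega] at hturan
  exact hiso (by nlinarith)

lemma card_edgeFinset_le_or_isExceptional {k : ℕ} (hr : 3 ≤ r)
    (hn : (if r = 3 then 26 else if r = 4 then 11 else 1) ≤ Fintype.card V)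
    (hG : G.CliqueFree (r + 1)) (hk : 2 ≤ k) (hkn : 2 * k < Fintype.card V)
    (hlow : k ≤ #{v | G.degree v ≤ k}) :
    #G.edgeFinset ≤ turanEdges (Fintype.card V - 1) r ∨
      Fintype.card V = 2 * k + 1 ∧ IsExceptional r k ∧
        #G.edgeFinset ≤ turanEdges (2 * k) r + 1 := by
  classical
  obtain ⟨S, hSlow, hS⟩ := exists_subset_card_eq hlow
  have hdeg : ∀ v ∈ S, G.degree v ≤ k := fun v hv => (mem_filter.1 (hSlow hv)).2
  have hle := card_edgeFinset_le_sq_add hG hS hdeg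
  obtain ⟨hkm, hcard⟩ : k < #Sᶜ ∧ Fintype.card V = #Sᶜ + (k - 1) + 1 := by
    have := card_add_card_compl S
    omega
  refine or_iff_not_imp_right.2 fun hex => ?_
  replace hex : #Sᶜ = k + 1 → ¬ IsExceptional r k := fun hm hrk =>
    hex ⟨by omega, hrk, by rwa [hm, hrk.sq_add_turanEdges] at hle⟩
  rw [hcard, Nat.add_sub_cancel]
  rw [hcard] at hn
  rcases (show r = 3 ∨ r = 4 ∨ 5 ≤ r by omega) with rfl | rfl | hr
  · rw [if_pos rfl] at hn
    rcases (show (#Sᶜ = k + 1 ∨ #Sᶜ = k + 2) ∨ k + 3 ≤ #Sᶜ by omega) with hm | hm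
    · exact card_edgeFinset_le_of_cliqueFree_four (by omega) hG hS hdeg hm
    · exact hle.trans (sq_add_turanEdges_le_of_three hk hm)
  · norm_num at hn
    exact hle.trans (sq_add_turanEdges_le_of_four hk hkm (by omega) hex)
  · exact hle.trans (sq_add_turanEdges_le_of_five_le hr hk hkm hex)

theorem card_edgeFinset_le_or_extremal_of_not_hasHamiltonianCycle [DecidableEq V] (hr : 3 ≤ r)
    (hn : (if r = 3 then 26 else if r = 4 then 11 else 1) ≤ Fintype.card V)
    (hG : G.CliqueFree (r + 1)) (hham : ¬ HasHamiltonianCycle G) :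
    #G.edgeFinset ≤ turanEdges (Fintype.card V - 1) r ∨
      #G.edgeFinset = turanEdges (Fintype.card V - 1) r + 1 ∧
        (IsTuranPlusVertex G r 1 ∨ IsSporadicExtremal G (Fintype.card V) r) := by
  rcases em (∃ u, G.degree u ≤ 1) with ⟨u, hu⟩ | hdeg
  · exact (card_edgeFinset_le_or_isTuranPlusVertex (by omega) hG hu).imp_right
      (And.imp_right Or.inl)
  have h3 : 3 ≤ Fintype.card V := by
    have hpos : 0 < Fintype.card V := lt_of_lt_of_le (by split_ifs <;> norm_num) hn
    obtain ⟨u⟩ := Fintype.card_pos_iff.1 hpos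
    by_contra
    exact hdeg ⟨u, by have := G.degree_lt_card_verts u; omega⟩
  obtain ⟨k, hk1, hkn, hlow, hlow'⟩ := exists_degree_condition_of_not_hasHamiltonianCycle h3 hham
  have hk : 2 ≤ k := by
    obtain ⟨u, hu⟩ := card_pos.1 (hk1.trans hlow)
    by_contra
    exact hdeg ⟨u, (mem_filter.1 hu).2.trans (by omega)⟩
  rcases card_edgeFinset_le_or_isExceptional hr hn hG hk hkn hlow with h | ⟨hV, hrk, hle⟩
  · exact Or.inl h
  rw [hV, show 2 * k + 1 - k = k + 1 by omega] at hlow'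
  simp only [Nat.lt_succ_iff] at hlow'
  rw [hV, Nat.add_sub_cancel]
  exact or_iff_not_imp_left.2 fun hlt => ⟨by omega, Or.inr <|
    isSporadicExtremal_of_isExceptional hrk hV hG hlow' (not_le.1 hlt)⟩

end Extremal

theorem mainTheorem1 {V : Type*} [Fintype V] [DecidableEq V]
    (G : SimpleGraph V) [DecidableRel G.Adj] (n r : ℕ)
    (hV : Fintype.card V = n) (hr : 3 ≤ r)
    (hn : (if r = 3 then 26 else if r = 4 then 11 else 1) ≤ n) :
    (G.CliqueFree (r + 1) → ¬ HasHamiltonianCycle G →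
      G.edgeFinset.card ≤ (SimpleGraph.turanGraph (n - 1) r).edgeFinset.card + 1) ∧
    ((G.CliqueFree (r + 1) ∧ ¬ HasHamiltonianCycle G ∧
        G.edgeFinset.card = (SimpleGraph.turanGraph (n - 1) r).edgeFinset.card + 1) ↔
      (IsTuranPlusVertex G r 1 ∨
        (5 ≤ r ∧ n = 5 ∧ Nonempty (G ≃g multipartite ![3, 1, 1])) ∨
        (r = 4 ∧ n = 11 ∧ Nonempty (G ≃g multipartite ![6, 2, 2, 1])) ∨
        (r = 5 ∧ n = 7 ∧ Nonempty (G ≃g multipartite ![4, 1, 1, 1])) ∨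
        (r = 5 ∧ n = 9 ∧ Nonempty (G ≃g multipartite ![5, 1, 1, 1, 1])))) := by
  subst hV
  have hbound := card_edgeFinset_le_or_extremal_of_not_hasHamiltonianCycle (G := G) hr hn
  refine ⟨fun hG hham => ?_, fun ⟨hG, hham, heq⟩ => ?_, ?_⟩
  · rcases hbound hG hham with hle | ⟨heq, -⟩
    · exact Nat.le_succ_of_le hle
    · exact heq.le
  · rcases hbound hG hham with hle | ⟨-, hextremal⟩
    · exact absurd heq (Nat.lt_succ_of_le hle).ne
    · exact hextremal
  · rintro ((h : IsTuranPlusVertex G r 1) | (h : IsSporadicExtremal G (Fintype.card V) r))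
    · exact ⟨h.1, h.not_hasHamiltonianCycle, h.card_edgeFinset⟩
    · exact ⟨h.cliqueFree, h.not_hasHamiltonianCycle, h.card_edgeFinset⟩
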